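/- Let $f$ be a monic complex polynomial of degree $n\ge 2$, and let $1\le p,q\le\infty$ with $1/p+1/q=1$. Let $\|\cdot\|_p$ be the $p$-norm on $\mathbb{C}^n$. For $z\in\mathbb{C}^n$ with distinct components put $$W_i(z)=\frac{f(z_i)}{\prod_{j\ne i}(z_i-z_j)},\qquad d_i(z)=\min_{j\ne i}|z_i-z_j|,\qquad E(z)=\left\|\left(\frac{W_1(z)}{d_1(z)},\dots,\frac{W_n(z)}{d_n(z)}\right)\right\|_p ,$$ and $W(z)=(W_1(z),\dots,W_n(z))$. Ehrlich's iteration is $z^{k+1}=F(z^k)$, $k=0,1,2,\dots$, where $$F_i(z)=z_i-\frac{f(z_i)}{f'(z_i)-f(z_i)\sum_{j\ne i}\frac{1}{z_i-z_j}}\qquad(i=1,\dots,n).$$ A root-vector of $f$ is a vector $\xi\in\mathbb{C}^n$ whose components are exactly the zeros of $f$ with their multiplicities. Let $a=(n-1)^{1/q}$, $b=2^{1/q}$, and $$\phi(x)=\frac{a x^2}{(1-(a+1)x)(1-(a+b)x)}\left(1+\frac{1}{n-1}\cdot\frac{ax}{1-(a+b)x}\right)^{n-1},$$ $$\psi(x)=\frac{1-(a+b)x}{1-ax},\qquad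 \mu(x)=\frac{1}{1-ax}.$$ Suppose that $z^0\in\mathbb{C}^n$ has distinct components and satisfies $E(z^0)<1/(a+b)$ and $\phi(E(z^0))\le 1$. Put $\lambda=\phi(E(z^0))$ and $\theta=\psi(E(z^0))$. Then: 1. Ehrlich's sequence $(z^k)$ is well defined (every $z^k$ has distinct components and no denominator in $F(z^k)$ vanishes) and converges to a root-vector $\xi$ of $f$. If $\lambda<1$, then the order of convergence is (at least) three, that is, there is a constant $C$ with $\|z^{k+1}-\xi\|_p\le C\,\|z^k-\xi\|_p^3$ for all $k\ge 0$. 2. For every $k\ge 1$ one has $\theta\lambda^{3^k}<1$ and $$\|z^k-\xi\|_p\le A_k\,\frac{\theta^k\lambda^{(3^k-1)/2}}{1-\theta\lambda^{3^k}}\,\|W(z^0)\|_p,\qquad A_k=\mu\!\left(E(z^0)\lambda^{(3^k-1)/2}\right).$$ 3. For every $k\ge 0$ one has $E(z^k)<1/(a+b)$ and, with $\lambda_k=\phi(E(z^k))$, $\theta_k=\psi(E(z^k))$, $\mu_k=\mu(E(z^k))$, also $\theta_k\lambda_k<1$ and $$\|z^k-\xi\|_p\le\frac{\mu_k}{1-\theta_k\lambda_k}\,\|W(z^k)\|_p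 .$$ -/

import Mathlib

open scoped ENNReal

namespace Ehrlich

noncomputable section

/-- The `p`-norm on `ℂⁿ`: `(∑ |z_i|^p)^(1/p)` for `p < ∞` and `max |z_i|` for `p = ∞`. -/
def pNorm {n : ℕ} (p : ℝ≥0∞) (z : Fin n → ℂ) : ℝ :=
  ‖(WithLp.toLp p z : PiLp p (fun _ : Fin n => ℂ))‖

/-- `ξ` is a root-vector of `f`: its components are exactly the zeros of `f`, with
multiplicities. -/
def IsRootVector {n : ℕ} (f : Polynomial ℂ) (ξ : Fin n → ℂ) : Prop :=
  f.roots = (Finset.univ : Finset (Fin n)).val.map ξ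

/-- The Weierstrass correction `W_i(z) = f(z_i) / ∏_{j ≠ i} (z_i - z_j)`. -/
def weierstrass {n : ℕ} (f : Polynomial ℂ) (z : Fin n → ℂ) (i : Fin n) : ℂ :=
  f.eval (z i) / ∏ j ∈ Finset.univ.erase i, (z i - z j)

/-- `d_i(z) = min {|z_i - z_j| : j ≠ i}` (a minimum over a nonempty finite set for `n ≥ 2`). -/
def sep {n : ℕ} (z : Fin n → ℂ) (i : Fin n) : ℝ :=
  ⨅ j : {j : Fin n // j ≠ i}, ‖z i - z j‖

/-- `E(z) = ‖W(z) / d(z)‖_p`, the quotient being taken componentwise. -/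
def E {n : ℕ} (p : ℝ≥0∞) (f : Polynomial ℂ) (z : Fin n → ℂ) : ℝ :=
  pNorm p (fun i => weierstrass f z i / (sep z i : ℂ))

/-- The denominator `f'(z_i) - f(z_i) ∑_{j ≠ i} 1 / (z_i - z_j)` in Ehrlich's iteration. -/
def denom {n : ℕ} (f : Polynomial ℂ) (z : Fin n → ℂ) (i : Fin n) : ℂ :=
  f.derivative.eval (z i) - f.eval (z i) * ∑ j ∈ Finset.univ.erase i, 1 / (z i - z j)

/-- Ehrlich's iteration function `F`. -/
def ehrlichMap {n : ℕ} (f : Polynomial ℂ) (z : Fin n → ℂ) : Fin n → ℂ :=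
  fun i => z i - f.eval (z i) / denom f z i

/-- `F(z)` is defined: no division by zero occurs in any component. -/
def InDomain {n : ℕ} (f : Polynomial ℂ) (z : Fin n → ℂ) : Prop :=
  Function.Injective z ∧ ∀ i, denom f z i ≠ 0

/-- Ehrlich's sequence `z^{k+1} = F(z^k)` started at `z0`. -/
def ehrlichSeq {n : ℕ} (f : Polynomial ℂ) (z0 : Fin n → ℂ) : ℕ → Fin n → ℂ
  | 0 => z0
  | k + 1 => ehrlichMap f (ehrlichSeq f z0 k)

/-- The sequence `u` converges to `ξ` with (Q-)order (at least) `r`, errors measured in the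
`p`-norm. -/
def ConvergesWithOrder {n : ℕ} (p : ℝ≥0∞) (r : ℕ) (u : ℕ → Fin n → ℂ) (ξ : Fin n → ℂ) : Prop :=
  Filter.Tendsto u Filter.atTop (nhds ξ) ∧
    ∃ C : ℝ, ∀ k, pNorm p (u (k + 1) - ξ) ≤ C * pNorm p (u k - ξ) ^ r

/-- The gauge function `φ`, for given `n`, `a`, `b`. -/
def phi (n : ℕ) (a b x : ℝ) : ℝ :=
  a * x ^ 2 / ((1 - (a + 1) * x) * (1 - (a + b) * x)) *
    (1 + 1 / ((n : ℝ) - 1) * (a * x / (1 - (a + b) * x))) ^ (n - 1)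

/-- `ψ(x) = (1 - (a + b) x) / (1 - a x)`. -/
def psi (a b x : ℝ) : ℝ := (1 - (a + b) * x) / (1 - a * x)

/-- `μ(x) = 1 / (1 - a x)`. -/
def mu (a x : ℝ) : ℝ := 1 / (1 - a * x)

end

end Ehrlich

/-!
One step `z ↦ z'` of Ehrlich's iteration is analysed through the Weierstrass corrections `W_i`.
Lagrange's interpolation formula (`eq_nodal_add_sum`, `eval_eq_prod_mul`) turns the iteration into
the Börsch-Supan form `z'_i - z_i = -W_i / (1 + ∑_{j ≠ i} W_j / (z_i - z_j))`. Hölder's inequality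
bounds the sum in the denominator by `a E(z) < 1`, so that the step is defined and is at most
`μ(E(z)) |W_i|`; together with the bound `b E(z)` for two components this gives
`|z'_i - z'_j| ≥ ψ(E(z)) |z_i - z_j|`. The choice of the step cancels the leading terms of
Lagrange's formula at `z'_i` (`eval_ehrlichMap`), and the inequality of the arithmetic and
geometric means then yields `|W_i(z')| ≤ ψ(E(z)) φ(E(z)) |W_i(z)|`
(`norm_weierstrass_ehrlichMap_le`). Dividing by the separations gives `E(z') ≤ φ(E(z)) E(z)`.

Both `φ(x)` and `ψ(x) φ(x)` are `x²` times an increasing function, hence `φ(E(z')) ≤ φ(E(z))³`;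
by induction `φ(E(z^k)) ≤ λ^(3^k)`, `E(z^k) ≤ λ^((3^k - 1) / 2) E(z^0)` and
`ψ(E(z^k)) φ(E(z^k)) ≤ θ λ^(3^k)`. In particular `ψ φ ≤ θ λ < 1` along the sequence, the increments
are dominated by a geometric series, and summing it gives convergence and both error estimates.
The corrections tend to zero, so Lagrange's formula tends to `f = ∏ (X - ξ_j)` and the limit is a
root-vector.

If `λ < 1`, then `E(z^k) → 0` and the a posteriori estimate forces the components of the limit to
be distinct. Then `W(z^k)` and `E(z^k)` are at most proportional to the error `‖z^k - ξ‖`, while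
`‖z^{k+1} - ξ‖` is at most proportional to `E(z^k)² ‖W(z^k)‖`: the order is three.
-/

namespace Ehrlich

/-! ### The `p`-norm -/

lemma pNorm_nonneg {n : ℕ} {p : ℝ≥0∞} (hp : 1 ≤ p) (u : Fin n → ℂ) : 0 ≤ pNorm p u := by
  have : Fact (1 ≤ p) := ⟨hp⟩
  exact norm_nonneg _

/-- Hölder's inequality against the indicator function of `s`. The cases `#s = 1, 2, n - 1` are
where coordinatewise bounds and the constants `b` and `a` come from. -/
lemma sum_norm_le_card_rpow_mul_pNorm {n : ℕ} {p q : ℝ≥0∞} (hp : 1 ≤ p)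
    (hpq : 1 / p + 1 / q = 1) (s : Finset (Fin n)) (u : Fin n → ℂ) :
    ∑ i ∈ s, ‖u i‖ ≤ (s.card : ℝ) ^ (1 / q).toReal * pNorm p u := by
  have : Fact (1 ≤ p) := ⟨hp⟩
  rcases eq_or_ne p ∞ with rfl | hp'
  · have hq : (1 / q).toReal = 1 := by
      simp only [one_div, ENNReal.inv_top, zero_add] at hpq ⊢
      rw [hpq]; rfl
    rw [hq, Real.rpow_one, ← nsmul_eq_mul]
    exact Finset.sum_le_card_nsmul _ _ _ fun i _ =>
      PiLp.norm_apply_le (WithLp.toLp ∞ u : PiLp ∞ (fun _ : Fin n => ℂ)) i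
  · have hp1 : 1 ≤ p.toReal := by
      simpa using ENNReal.toReal_mono hp' hp
    have hp0 : 0 < p.toReal := one_pos.trans_le hp1
    have hq : (1 / q).toReal = 1 - 1 / p.toReal := by
      have h1 : 1 / p ≠ ∞ := fun h => by simp [h] at hpq
      have h2 : 1 / q ≠ ∞ := fun h => by simp [h] at hpq
      have := congrArg ENNReal.toReal hpq
      rw [ENNReal.toReal_add h1 h2] at this
      simp only [one_div, ENNReal.toReal_inv, ENNReal.toReal_one] at this ⊢
      linarith
    have hsum : 0 ≤ ∑ i ∈ s, ‖u i‖ := Finset.sum_nonneg fun i _ => norm_nonneg _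
    have key := Real.rpow_sum_le_const_mul_sum_rpow_of_nonneg s hp1
      (fun i _ => norm_nonneg (u i))
    have hmono : ∑ i ∈ s, ‖u i‖ ^ p.toReal ≤ ∑ i, ‖u i‖ ^ p.toReal :=
      Finset.sum_le_sum_of_subset_of_nonneg (Finset.subset_univ s)
        fun i _ _ => Real.rpow_nonneg (norm_nonneg _) _
    have hN : 0 ≤ ∑ i, ‖u i‖ ^ p.toReal :=
      Finset.sum_nonneg fun i _ => Real.rpow_nonneg (norm_nonneg _) _
    have hc : (0 : ℝ) ≤ s.card := Nat.cast_nonneg _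
    have h3 : (∑ i ∈ s, ‖u i‖) ^ p.toReal ≤
        (s.card : ℝ) ^ (p.toReal - 1) * ∑ i, ‖u i‖ ^ p.toReal :=
      key.trans (mul_le_mul_of_nonneg_left hmono (Real.rpow_nonneg hc _))
    have h4 := Real.rpow_le_rpow (Real.rpow_nonneg hsum _) h3 (one_div_pos.2 hp0).le
    rw [← Real.rpow_mul hsum, mul_one_div_cancel hp0.ne', Real.rpow_one,
      Real.mul_rpow (Real.rpow_nonneg hc _) hN, ← Real.rpow_mul hc] at h4
    have h5 : pNorm p u = (∑ i, ‖u i‖ ^ p.toReal) ^ (1 / p.toReal) :=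
      PiLp.norm_eq_sum hp0 _
    have h6 : (p.toReal - 1) * (1 / p.toReal) = 1 - 1 / p.toReal := by
      field_simp
    rw [h5, hq, ← h6]
    exact h4

lemma norm_apply_le_pNorm {n : ℕ} {p : ℝ≥0∞} (hp : 1 ≤ p) (u : Fin n → ℂ) (i : Fin n) :
    ‖u i‖ ≤ pNorm p u := by
  have : Fact (1 ≤ p) := ⟨hp⟩
  exact PiLp.norm_apply_le (WithLp.toLp p u : PiLp p (fun _ : Fin n => ℂ)) i

lemma pNorm_le_mul_of_norm_le {n : ℕ} {p : ℝ≥0∞} (hp : 1 ≤ p) {c : ℝ} (hc : 0 ≤ c)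
    {u v : Fin n → ℂ} (h : ∀ i, ‖u i‖ ≤ c * ‖v i‖) : pNorm p u ≤ c * pNorm p v := by
  have : Fact (1 ≤ p) := ⟨hp⟩
  rcases eq_or_ne p ∞ with rfl | hp'
  · have h0 := pNorm_nonneg le_top v
    exact Real.iSup_le (fun i => (h i).trans <|
      mul_le_mul_of_nonneg_left (norm_apply_le_pNorm le_top v i) hc) (mul_nonneg hc h0)
  · have hp1 : 1 ≤ p.toReal := by
      simpa using ENNReal.toReal_mono hp' hp
    have hp0 : 0 < p.toReal := one_pos.trans_le hp1
    have hu : pNorm p u = (∑ i, ‖u i‖ ^ p.toReal) ^ (1 / p.toReal) := PiLp.norm_eq_sum hp0 _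
    have hcv : pNorm p ((c : ℂ) • v) = (∑ i, ‖((c : ℂ) • v) i‖ ^ p.toReal) ^ (1 / p.toReal) :=
      PiLp.norm_eq_sum hp0 _
    have hsm : pNorm p ((c : ℂ) • v) = c * pNorm p v := by
      unfold pNorm
      rw [WithLp.toLp_smul, norm_smul, Complex.norm_real, Real.norm_of_nonneg hc]
    rw [← hsm, hu, hcv]
    refine Real.rpow_le_rpow (Finset.sum_nonneg fun i _ => Real.rpow_nonneg (norm_nonneg _) _)
      (Finset.sum_le_sum fun i _ => Real.rpow_le_rpow (norm_nonneg _) ?_ hp0.le)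
      (one_div_pos.2 hp0).le
    rw [Pi.smul_apply, norm_smul, Complex.norm_real, Real.norm_of_nonneg hc]
    exact h i

/-- The inequality of arithmetic and geometric means, in product form. -/
lemma prod_le_arith_mean_pow {ι : Type*} (s : Finset ι) (y : ι → ℝ) (hy : ∀ i ∈ s, 0 ≤ y i) :
    ∏ i ∈ s, y i ≤ ((∑ i ∈ s, y i) / s.card) ^ s.card := by
  rcases s.eq_empty_or_nonempty with rfl | hs
  · simp
  have hc : (0 : ℝ) < s.card := by exact_mod_cast hs.card_pos
  have h := Real.geom_mean_le_arith_mean s (fun _ => 1) y (fun _ _ => zero_le_one)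
    (by simpa using hs) hy
  simp only [Real.rpow_one, Finset.sum_const, nsmul_eq_mul, mul_one, one_mul] at h
  have hP : 0 ≤ ∏ i ∈ s, y i := Finset.prod_nonneg hy
  have h2 := pow_le_pow_left₀ (Real.rpow_nonneg hP _) h s.card
  rwa [Real.rpow_inv_natCast_pow hP hs.card_pos.ne'] at h2

/-! ### Separation of the components -/

lemma sep_le {n : ℕ} (z : Fin n → ℂ) {i j : Fin n} (h : j ≠ i) : sep z i ≤ ‖z i - z j‖ :=
  ciInf_le (f := fun j : {j : Fin n // j ≠ i} => ‖z i - z j‖)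
    (Set.finite_range _).bddBelow ⟨j, h⟩

lemma le_sep {n : ℕ} (hn : 2 ≤ n) (z : Fin n → ℂ) (i : Fin n) {c : ℝ}
    (h : ∀ j, j ≠ i → c ≤ ‖z i - z j‖) : c ≤ sep z i := by
  have : Nontrivial (Fin n) := Fin.nontrivial_iff_two_le.2 hn
  have : Nonempty {j : Fin n // j ≠ i} := (exists_ne i).elim fun j hj => ⟨⟨j, hj⟩⟩
  exact le_ciInf fun j => h j j.2

lemma sep_pos {n : ℕ} (hn : 2 ≤ n) {z : Fin n → ℂ} (hz : Function.Injective z) (i : Fin n) :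
    0 < sep z i := by
  have : Nontrivial (Fin n) := Fin.nontrivial_iff_two_le.2 hn
  have : Nonempty {j : Fin n // j ≠ i} := (exists_ne i).elim fun j hj => ⟨⟨j, hj⟩⟩
  obtain ⟨j, hj⟩ := exists_eq_ciInf_of_finite (f := fun j : {j : Fin n // j ≠ i} => ‖z i - z j‖)
  rw [sep, ← hj]
  exact norm_pos_iff.2 (sub_ne_zero.2 fun h => j.2 (hz h).symm)

/-! ### Lagrange interpolation and the correction -/

open Polynomial in
/-- Lagrange's formula: both sides are monic of degree `n` and agree at the `n` nodes `z_i`. -/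
lemma eq_nodal_add_sum {n : ℕ} {f : ℂ[X]} (hf : f.Monic) (hdeg : f.natDegree = n)
    {z : Fin n → ℂ} (hz : Function.Injective z) :
    f = Lagrange.nodal Finset.univ z +
      ∑ j, C (weierstrass f z j) * Lagrange.nodal (Finset.univ.erase j) z := by
  refine Polynomial.eq_of_degree_sub_lt_of_eval_index_eq (s := Finset.univ) (v := z)
    hz.injOn ?_ ?_
  · have h1 : (f - Lagrange.nodal Finset.univ z).degree < (n : WithBot ℕ) := by
      have hd : f.degree = n := by rw [degree_eq_natDegree hf.ne_zero, hdeg]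
      rw [← hd]
      refine degree_sub_lt_left ?_ hf.ne_zero ?_
      · rw [Lagrange.degree_nodal, hd]; simp
      · rw [hf.leadingCoeff, (Lagrange.nodal_monic).leadingCoeff]
    have h2 : (∑ j, C (weierstrass f z j) * Lagrange.nodal (Finset.univ.erase j) z).degree
        < (n : WithBot ℕ) := by
      refine (degree_sum_le _ _).trans_lt ?_
      refine (Finset.sup_lt_iff (WithBot.bot_lt_coe n)).2 fun j _ => ?_
      rw [← smul_eq_C_mul]
      refine (degree_smul_le _ _).trans_lt ?_
      rw [Lagrange.degree_nodal, Finset.card_erase_of_mem (Finset.mem_univ j), Finset.card_univ,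
        Fintype.card_fin]
      exact WithBot.coe_lt_coe.2 (Nat.sub_lt j.pos one_pos)
    rw [← sub_sub, Finset.card_univ, Fintype.card_fin]
    exact (degree_sub_le _ _).trans_lt (max_lt h1 h2)
  · intro i _
    rw [eval_add, Lagrange.eval_nodal_at_node (Finset.mem_univ i), zero_add, eval_finsetSum,
      Finset.sum_eq_single i]
    · rw [eval_mul, eval_C, Lagrange.eval_nodal, weierstrass, div_mul_cancel₀]
      exact Finset.prod_ne_zero_iff.2 fun j hj =>
        sub_ne_zero.2 fun h => (Finset.ne_of_mem_erase hj) (hz h).symm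
    · intro j _ hj
      rw [eval_mul, Lagrange.eval_nodal_at_node (Finset.mem_erase.2 ⟨hj.symm, Finset.mem_univ i⟩),
        mul_zero]
    · simp

lemma prod_erase_erase_eq_div {n : ℕ} (z : Fin n → ℂ) {i j : Fin n} (hj : j ≠ i) {x : ℂ}
    (hx : x ≠ z j) : ∏ k ∈ (Finset.univ.erase i).erase j, (x - z k) =
      (∏ k ∈ Finset.univ.erase i, (x - z k)) / (x - z j) := by
  rw [eq_div_iff (sub_ne_zero.2 hx)]
  exact Finset.prod_erase_mul _ (fun k => x - z k) (Finset.mem_erase.2 ⟨hj, Finset.mem_univ j⟩)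

/-- Lagrange's formula with the node `z i` singled out. -/
lemma eval_eq_prod_mul {n : ℕ} {f : Polynomial ℂ} (hf : f.Monic) (hdeg : f.natDegree = n)
    {z : Fin n → ℂ} (hz : Function.Injective z) (i : Fin n) {x : ℂ} (hx : ∀ j, j ≠ i → x ≠ z j) :
    f.eval x = (∏ j ∈ Finset.univ.erase i, (x - z j)) *
      ((x - z i) * (1 + ∑ j ∈ Finset.univ.erase i, weierstrass f z j / (x - z j)) +
        weierstrass f z i) := by
  have h := congrArg (Polynomial.eval x) (eq_nodal_add_sum hf hdeg hz)
  rw [Polynomial.eval_add, Polynomial.eval_finsetSum, Lagrange.eval_nodal,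
    ← Finset.add_sum_erase _ _ (Finset.mem_univ i)] at h
  have h2 : ∀ j ∈ Finset.univ.erase i, Polynomial.eval x
      (Polynomial.C (weierstrass f z j) * Lagrange.nodal (Finset.univ.erase j) z) =
      (∏ k ∈ Finset.univ.erase i, (x - z k)) * ((x - z i) *
        (weierstrass f z j / (x - z j))) := by
    intro j hj
    have hji := Finset.ne_of_mem_erase hj
    rw [Polynomial.eval_mul, Polynomial.eval_C, Lagrange.eval_nodal,
      ← Finset.prod_erase_mul _ _ (Finset.mem_erase.2 ⟨hji.symm, Finset.mem_univ i⟩),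
      Finset.erase_right_comm, prod_erase_erase_eq_div z hji (hx j hji)]
    ring
  rw [h, Finset.sum_congr rfl h2, ← Finset.mul_sum, ← Finset.mul_sum,
    ← Finset.mul_prod_erase _ _ (Finset.mem_univ i), Polynomial.eval_mul, Polynomial.eval_C,
    Lagrange.eval_nodal]
  ring

/-- Ehrlich's denominator in terms of the Weierstrass corrections. It turns the iteration into
the Börsch-Supan form `F_i(z) = z_i - W_i / (1 + ∑_{j ≠ i} W_j / (z_i - z_j))`. -/
lemma denom_eq {n : ℕ} {f : Polynomial ℂ} (hf : f.Monic) (hdeg : f.natDegree = n)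
    {z : Fin n → ℂ} (hz : Function.Injective z) (i : Fin n) :
    denom f z i = (∏ j ∈ Finset.univ.erase i, (z i - z j)) *
      (1 + ∑ j ∈ Finset.univ.erase i, weierstrass f z j / (z i - z j)) := by
  have hne : ∀ j, j ≠ i → z i ≠ z j := fun j hj h => hj (hz h).symm
  have hQ : ∏ j ∈ Finset.univ.erase i, (z i - z j) ≠ 0 :=
    Finset.prod_ne_zero_iff.2 fun j hj => sub_ne_zero.2 (hne j (Finset.ne_of_mem_erase hj))
  have hW : f.eval (z i) = weierstrass f z i * ∏ j ∈ Finset.univ.erase i, (z i - z j) := by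
    rw [weierstrass, div_mul_cancel₀ _ hQ]
  have h := congrArg (fun g => Polynomial.eval (z i) (Polynomial.derivative g))
    (eq_nodal_add_sum hf hdeg hz)
  simp only [Polynomial.derivative_add, Polynomial.derivative_sum, Polynomial.derivative_C_mul,
    Polynomial.eval_add, Polynomial.eval_finsetSum, Polynomial.eval_C_mul] at h
  rw [Lagrange.eval_nodal_derivative_eval_node_eq (Finset.mem_univ i), Lagrange.eval_nodal,
    ← Finset.add_sum_erase _ _ (Finset.mem_univ i), Lagrange.derivative_nodal,
    Polynomial.eval_finsetSum] at h
  have h1 : ∑ j ∈ Finset.univ.erase i, Polynomial.eval (z i)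
      (Lagrange.nodal ((Finset.univ.erase i).erase j) z) =
      (∏ j ∈ Finset.univ.erase i, (z i - z j)) * ∑ j ∈ Finset.univ.erase i, 1 / (z i - z j) := by
    rw [Finset.mul_sum]
    refine Finset.sum_congr rfl fun j hj => ?_
    have hji := Finset.ne_of_mem_erase hj
    rw [Lagrange.eval_nodal, prod_erase_erase_eq_div z hji (hne j hji), mul_one_div]
  have h2 : ∑ j ∈ Finset.univ.erase i, weierstrass f z j * Polynomial.eval (z i)
      (Polynomial.derivative (Lagrange.nodal (Finset.univ.erase j) z)) =
      (∏ j ∈ Finset.univ.erase i, (z i - z j)) *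
        ∑ j ∈ Finset.univ.erase i, weierstrass f z j / (z i - z j) := by
    rw [Finset.mul_sum]
    refine Finset.sum_congr rfl fun j hj => ?_
    have hji := Finset.ne_of_mem_erase hj
    rw [Lagrange.eval_nodal_derivative_eval_node_eq
      (Finset.mem_erase.2 ⟨hji.symm, Finset.mem_univ i⟩), Lagrange.eval_nodal,
      Finset.erase_right_comm, prod_erase_erase_eq_div z hji (hne j hji)]
    ring
  rw [denom, h, h1, h2, hW]
  ring

/-! ### Monotonicity of the gauge functions -/

/-- The factor `G` in `φ(x) = x² G(x)`. -/
noncomputable def phiFactor (n : ℕ) (a b x : ℝ) : ℝ :=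
  a / ((1 - (a + 1) * x) * (1 - (a + b) * x)) *
    (1 + 1 / ((n : ℝ) - 1) * (a * x / (1 - (a + b) * x))) ^ (n - 1)

/-- The factor `H` in `ψ(x) φ(x) = x² H(x)`. -/
noncomputable def psiPhiFactor (n : ℕ) (a b x : ℝ) : ℝ :=
  a / ((1 - (a + 1) * x) * (1 - a * x)) *
    (1 + 1 / ((n : ℝ) - 1) * (a * x / (1 - (a + b) * x))) ^ (n - 1)

lemma phi_eq (n : ℕ) (a b x : ℝ) : phi n a b x = x ^ 2 * phiFactor n a b x := by
  unfold phi phiFactor; ring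

lemma psi_mul_phi_eq (n : ℕ) {a b x : ℝ} (h : (a + b) * x < 1) :
    psi a b x * phi n a b x = x ^ 2 * psiPhiFactor n a b x := by
  have h1 : 1 - (a + b) * x ≠ 0 := by linarith
  rw [psi, phi, psiPhiFactor, ← mul_assoc, ← mul_assoc]
  congr 1
  rw [div_mul_div_comm, mul_comm (1 - a * x), mul_right_comm (1 - (a + 1) * x),
    mul_comm (1 - (a + b) * x), mul_div_mul_right _ _ h1]
  ring

lemma one_sub_pos_of_gauge {a b x : ℝ} (hb : 1 ≤ b) (hx0 : 0 ≤ x) (hx : (a + b) * x < 1) :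
    0 < 1 - a * x ∧ 0 < 1 - (a + 1) * x ∧ 0 < 1 - (a + b) * x := by
  refine ⟨?_, ?_, by linarith⟩ <;> nlinarith

/-- The power that `phiFactor` and `psiPhiFactor` have in common is nonnegative and increasing. -/
lemma gauge_power_mono {n : ℕ} {a b x y : ℝ} (hn : 2 ≤ n) (ha : 0 ≤ a) (hb : 1 ≤ b)
    (hy : 0 ≤ y) (hyx : y ≤ x) (hx : (a + b) * x < 1) :
    0 ≤ (1 + 1 / ((n : ℝ) - 1) * (a * y / (1 - (a + b) * y))) ^ (n - 1) ∧
    (1 + 1 / ((n : ℝ) - 1) * (a * y / (1 - (a + b) * y))) ^ (n - 1) ≤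
    (1 + 1 / ((n : ℝ) - 1) * (a * x / (1 - (a + b) * x))) ^ (n - 1) := by
  have hn' : (2 : ℝ) ≤ n := by exact_mod_cast hn
  have hn1 : 0 < (n : ℝ) - 1 := by linarith
  obtain ⟨-, -, h1⟩ := one_sub_pos_of_gauge hb (hy.trans hyx) hx
  have h2 : 1 - (a + b) * x ≤ 1 - (a + b) * y := by nlinarith
  have h3 : 0 ≤ a * y / (1 - (a + b) * y) := div_nonneg (by positivity) (by linarith)
  constructor
  · positivity
  · have := hy.trans hyx
    gcongr

lemma phiFactor_mono {n : ℕ} {a b x y : ℝ} (hn : 2 ≤ n) (ha : 0 ≤ a) (hb : 1 ≤ b)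
    (hy : 0 ≤ y) (hyx : y ≤ x) (hx : (a + b) * x < 1) :
    0 ≤ phiFactor n a b y ∧ phiFactor n a b y ≤ phiFactor n a b x := by
  obtain ⟨-, h1, h2⟩ := one_sub_pos_of_gauge hb (hy.trans hyx) hx
  obtain ⟨h3, h4⟩ := gauge_power_mono hn ha hb hy hyx hx
  have h5 : 1 - (a + 1) * x ≤ 1 - (a + 1) * y := by nlinarith
  have h6 : 1 - (a + b) * x ≤ 1 - (a + b) * y := by nlinarith
  unfold phiFactor
  constructor
  · exact mul_nonneg (div_nonneg ha (mul_nonneg (by linarith) (by linarith))) h3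
  · have h7 : 0 ≤ 1 - (a + 1) * y := by linarith
    gcongr

lemma psiPhiFactor_mono {n : ℕ} {a b x y : ℝ} (hn : 2 ≤ n) (ha : 0 ≤ a) (hb : 1 ≤ b)
    (hy : 0 ≤ y) (hyx : y ≤ x) (hx : (a + b) * x < 1) :
    0 ≤ psiPhiFactor n a b y ∧ psiPhiFactor n a b y ≤ psiPhiFactor n a b x := by
  obtain ⟨h2, h1, -⟩ := one_sub_pos_of_gauge hb (hy.trans hyx) hx
  obtain ⟨h3, h4⟩ := gauge_power_mono hn ha hb hy hyx hx
  have h5 : 1 - (a + 1) * x ≤ 1 - (a + 1) * y := by nlinarith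
  have h6 : 1 - a * x ≤ 1 - a * y := by nlinarith
  unfold psiPhiFactor
  constructor
  · exact mul_nonneg (div_nonneg ha (mul_nonneg (by linarith) (by linarith))) h3
  · have h7 : 0 ≤ 1 - (a + 1) * y := by linarith
    gcongr

/-- Quasi-homogeneity of `φ` of degree two: `φ(y) ≤ s² φ(x)` for `y ≤ s x`. -/
lemma phi_le_sq_mul {n : ℕ} {a b x y s : ℝ} (hn : 2 ≤ n) (ha : 0 ≤ a) (hb : 1 ≤ b) (hy : 0 ≤ y)
    (hx0 : 0 ≤ x) (hs : s ≤ 1) (hysx : y ≤ s * x) (hx : (a + b) * x < 1) :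
    phi n a b y ≤ s ^ 2 * phi n a b x := by
  have hyx : y ≤ x := hysx.trans (by nlinarith)
  obtain ⟨h1, h2⟩ := phiFactor_mono hn ha hb hy hyx hx
  rw [phi_eq, phi_eq, ← mul_assoc, ← mul_pow]
  gcongr

lemma psi_mul_phi_le_sq_mul {n : ℕ} {a b x y s : ℝ} (hn : 2 ≤ n) (ha : 0 ≤ a) (hb : 1 ≤ b)
    (hy : 0 ≤ y) (hx0 : 0 ≤ x) (hs : s ≤ 1) (hysx : y ≤ s * x) (hx : (a + b) * x < 1) :
    psi a b y * phi n a b y ≤ s ^ 2 * (psi a b x * phi n a b x) := by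
  have hyx : y ≤ x := hysx.trans (by nlinarith)
  obtain ⟨h1, h2⟩ := psiPhiFactor_mono hn ha hb hy hyx hx
  rw [psi_mul_phi_eq n hx, psi_mul_phi_eq n (show (a + b) * y < 1 by nlinarith), ← mul_assoc,
    ← mul_pow]
  gcongr

lemma phi_nonneg {n : ℕ} {a b x : ℝ} (hn : 2 ≤ n) (ha : 0 ≤ a) (hb : 1 ≤ b) (hx0 : 0 ≤ x)
    (hx : (a + b) * x < 1) : 0 ≤ phi n a b x := by
  rw [phi_eq]
  exact mul_nonneg (sq_nonneg x) (phiFactor_mono hn ha hb hx0 le_rfl hx).1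

lemma psi_pos {a b x : ℝ} (hb : 1 ≤ b) (hx0 : 0 ≤ x) (hx : (a + b) * x < 1) :
    0 < psi a b x := by
  obtain ⟨h1, -, h3⟩ := one_sub_pos_of_gauge hb hx0 hx
  exact div_pos h3 h1

/-- For `x > 0` the factor `ψ(x)` is strictly less than one, and `φ(0) = 0`; so the product stays
below one even in the boundary case `φ(x) = 1`. -/
lemma psi_mul_phi_lt_one {n : ℕ} {a b x : ℝ} (hb : 1 ≤ b) (hx0 : 0 ≤ x)
    (hx : (a + b) * x < 1) (hphi : phi n a b x ≤ 1) : psi a b x * phi n a b x < 1 := by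
  rcases hx0.eq_or_lt with rfl | h0
  · simp [phi]
  · obtain ⟨h1, -, -⟩ := one_sub_pos_of_gauge hb hx0 hx
    have h2 : psi a b x < 1 := by
      rw [psi, div_lt_one h1]
      nlinarith
    have h3 := psi_pos hb hx0 hx
    nlinarith

lemma mu_mono {a b x y : ℝ} (ha : 0 ≤ a) (hb : 1 ≤ b) (hy : 0 ≤ y) (hyx : y ≤ x)
    (hx : (a + b) * x < 1) : 0 < mu a y ∧ mu a y ≤ mu a x := by
  obtain ⟨h1, -, -⟩ := one_sub_pos_of_gauge hb (hy.trans hyx) hx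
  have h2 : 1 - a * x ≤ 1 - a * y := by nlinarith
  exact ⟨one_div_pos.2 (h1.trans_le h2), one_div_le_one_div_of_le h1 h2⟩

/-! ### One step of the iteration -/

/-- The consequences of `E(z) = x` that the analysis of one step uses: `z` has distinct
components, `x < 1 / (a + b)`, and the numbers `|W_i(z)| / d_i(z)` are at most `x`, their sums
over all indices but one at most `a x`, and their sums over two indices at most `b x`. -/
structure StepBound {n : ℕ} (f : Polynomial ℂ) (a b x : ℝ) (z : Fin n → ℂ) : Prop where
  injective : Function.Injective z
  nonneg : 0 ≤ x
  lt_one : (a + b) * x < 1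
  single : ∀ i, ‖weierstrass f z i‖ / sep z i ≤ x
  erase : ∀ i, ∑ j ∈ Finset.univ.erase i, ‖weierstrass f z j‖ / sep z j ≤ a * x
  pair : ∀ i j, j ≠ i →
    ‖weierstrass f z i‖ / sep z i + ‖weierstrass f z j‖ / sep z j ≤ b * x

lemma E_nonneg {n : ℕ} {p : ℝ≥0∞} (hp : 1 ≤ p) (f : Polynomial ℂ) (z : Fin n → ℂ) :
    0 ≤ E p f z :=
  pNorm_nonneg hp _

lemma stepBound_E {n : ℕ} (hn : 2 ≤ n) {p q : ℝ≥0∞} (hp : 1 ≤ p) (hpq : 1 / p + 1 / q = 1)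
    {a b : ℝ} (ha : a = ((n : ℝ) - 1) ^ (1 / q).toReal) (hb : b = (2 : ℝ) ^ (1 / q).toReal)
    {f : Polynomial ℂ} {z : Fin n → ℂ} (hz : Function.Injective z)
    (hE : (a + b) * E p f z < 1) : StepBound f a b (E p f z) z := by
  have hnorm : ∀ i, ‖weierstrass f z i / (sep z i : ℂ)‖ = ‖weierstrass f z i‖ / sep z i := by
    intro i
    rw [norm_div, Complex.norm_real, Real.norm_of_nonneg (sep_pos hn hz i).le]
  have hsum := fun s : Finset (Fin n) =>
    sum_norm_le_card_rpow_mul_pNorm hp hpq s (fun i => weierstrass f z i / (sep z i : ℂ))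
  simp only [hnorm] at hsum
  refine ⟨hz, E_nonneg hp f z, hE, fun i => ?_, fun i => ?_, fun i j hij => ?_⟩
  · rw [← hnorm]
    exact norm_apply_le_pNorm hp (fun i => weierstrass f z i / (sep z i : ℂ)) i
  · have h := hsum (Finset.univ.erase i)
    rwa [Finset.card_erase_of_mem (Finset.mem_univ i), Finset.card_univ, Fintype.card_fin,
      Nat.cast_sub (by omega), Nat.cast_one, ← ha] at h
  · have h := hsum {i, j}
    rwa [Finset.sum_pair hij.symm, Finset.card_pair hij.symm, Nat.cast_ofNat, ← hb] at h

section Step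

variable {n : ℕ} {f : Polynomial ℂ} {a b x : ℝ} {z : Fin n → ℂ}

lemma norm_sub_pos (h : StepBound f a b x z) {i j : Fin n} (hij : j ≠ i) :
    0 < ‖z i - z j‖ :=
  norm_pos_iff.2 (sub_ne_zero.2 fun e => hij (h.injective e).symm)

lemma norm_sum_weierstrass_div_le (hn : 2 ≤ n) (h : StepBound f a b x z) (i : Fin n) :
    ‖∑ j ∈ Finset.univ.erase i, weierstrass f z j / (z i - z j)‖ ≤ a * x := by
  refine (norm_sum_le _ _).trans ((Finset.sum_le_sum fun j hj => ?_).trans (h.erase i))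
  have hij := Finset.ne_of_mem_erase hj
  rw [norm_div]
  refine div_le_div_of_nonneg_left (norm_nonneg _) (sep_pos hn h.injective j) ?_
  rw [norm_sub_rev]
  exact sep_le z hij.symm

lemma one_sub_le_norm_one_add_sum (hn : 2 ≤ n) (h : StepBound f a b x z) (i : Fin n) :
    1 - a * x ≤ ‖1 + ∑ j ∈ Finset.univ.erase i, weierstrass f z j / (z i - z j)‖ := by
  have h1 := norm_sum_weierstrass_div_le hn h i
  -- `‖1‖ ≤ ‖1 + S‖ + ‖S‖`
  have h2 := norm_sub_le (1 + ∑ j ∈ Finset.univ.erase i, weierstrass f z j / (z i - z j))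
    (∑ j ∈ Finset.univ.erase i, weierstrass f z j / (z i - z j))
  rw [add_sub_cancel_right, norm_one] at h2
  linarith

lemma one_add_sum_ne_zero (hn : 2 ≤ n) (hb : 1 ≤ b) (h : StepBound f a b x z) (i : Fin n) :
    1 + ∑ j ∈ Finset.univ.erase i, weierstrass f z j / (z i - z j) ≠ 0 := by
  obtain ⟨h1, -, -⟩ := one_sub_pos_of_gauge hb h.nonneg h.lt_one
  exact norm_pos_iff.1 (h1.trans_le (one_sub_le_norm_one_add_sum hn h i))

lemma prod_sub_ne_zero (hz : Function.Injective z) (i : Fin n) :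
    ∏ j ∈ Finset.univ.erase i, (z i - z j) ≠ 0 :=
  Finset.prod_ne_zero_iff.2 fun _ hj => sub_ne_zero.2 fun e => Finset.ne_of_mem_erase hj (hz e).symm

lemma inDomain (hn : 2 ≤ n) (hf : f.Monic) (hdeg : f.natDegree = n) (hb : 1 ≤ b)
    (h : StepBound f a b x z) : InDomain f z := by
  refine ⟨h.injective, fun i => ?_⟩
  rw [denom_eq hf hdeg h.injective]
  exact mul_ne_zero (prod_sub_ne_zero h.injective i) (one_add_sum_ne_zero hn hb h i)

/-- The Börsch-Supan form of Ehrlich's iteration. -/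
lemma ehrlichMap_sub_mul (hn : 2 ≤ n) (hf : f.Monic) (hdeg : f.natDegree = n) (hb : 1 ≤ b)
    (h : StepBound f a b x z) (i : Fin n) :
    (ehrlichMap f z i - z i) *
      (1 + ∑ j ∈ Finset.univ.erase i, weierstrass f z j / (z i - z j)) = -weierstrass f z i := by
  have h1 := prod_sub_ne_zero h.injective i
  have h2 := one_add_sum_ne_zero hn hb h i
  rw [ehrlichMap, denom_eq hf hdeg h.injective, weierstrass]
  field_simp
  ring

lemma norm_ehrlichMap_sub_le (hn : 2 ≤ n) (hf : f.Monic) (hdeg : f.natDegree = n) (hb : 1 ≤ b)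
    (h : StepBound f a b x z) (i : Fin n) :
    ‖ehrlichMap f z i - z i‖ ≤ mu a x * ‖weierstrass f z i‖ := by
  obtain ⟨h1, -, -⟩ := one_sub_pos_of_gauge hb h.nonneg h.lt_one
  have h2 := congrArg norm (ehrlichMap_sub_mul hn hf hdeg hb h i)
  rw [norm_mul, norm_neg] at h2
  rw [mu, one_div_mul_eq_div, le_div_iff₀ h1, ← h2]
  exact mul_le_mul_of_nonneg_left (one_sub_le_norm_one_add_sum hn h i) (norm_nonneg _)

lemma norm_weierstrass_le (hn : 2 ≤ n) (h : StepBound f a b x z) {i j : Fin n} (hij : j ≠ i) :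
    ‖weierstrass f z i‖ ≤ ‖weierstrass f z i‖ / sep z i * ‖z i - z j‖ := by
  have h1 := sep_pos hn h.injective i
  rw [div_mul_eq_mul_div, le_div_iff₀ h1]
  exact mul_le_mul_of_nonneg_left (sep_le z hij) (norm_nonneg _)

/-- The new `i`-th component stays away from the other old components, so that Lagrange's formula
with the node `z i` singled out applies at it. -/
lemma norm_ehrlichMap_sub_ge (hn : 2 ≤ n) (hf : f.Monic) (hdeg : f.natDegree = n) (hb : 1 ≤ b)
    (h : StepBound f a b x z) {i j : Fin n} (hij : j ≠ i) :
    (1 - (a + 1) * x) / (1 - a * x) * ‖z i - z j‖ ≤ ‖ehrlichMap f z i - z j‖ := by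
  obtain ⟨h1, -, -⟩ := one_sub_pos_of_gauge hb h.nonneg h.lt_one
  have h2 := norm_ehrlichMap_sub_le hn hf hdeg hb h i
  have h3 := norm_weierstrass_le hn h hij
  have h4 := mul_le_mul_of_nonneg_right (h.single i) (norm_nonneg (z i - z j))
  have h5 := norm_sub_le (ehrlichMap f z i - z j) (ehrlichMap f z i - z i)
  rw [sub_sub_sub_cancel_left, norm_sub_rev] at h5
  have h6 : mu a x * ‖weierstrass f z i‖ ≤ mu a x * (x * ‖z i - z j‖) :=
    mul_le_mul_of_nonneg_left (h3.trans h4) (one_div_pos.2 h1).le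
  have h7 : (1 - (a + 1) * x) / (1 - a * x) = 1 - mu a x * x := by
    rw [mu]; field_simp; ring
  have h8 : ‖z i - z j‖ = ‖z j - z i‖ := norm_sub_rev _ _
  rw [h7]
  linarith

/-- One step keeps the components apart, up to the factor `ψ`. -/
lemma psi_mul_norm_sub_le (hn : 2 ≤ n) (hf : f.Monic) (hdeg : f.natDegree = n) (hb : 1 ≤ b)
    (h : StepBound f a b x z) {i j : Fin n} (hij : j ≠ i) :
    psi a b x * ‖z i - z j‖ ≤ ‖ehrlichMap f z i - ehrlichMap f z j‖ := by
  obtain ⟨h1, -, -⟩ := one_sub_pos_of_gauge hb h.nonneg h.lt_one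
  have h2 := norm_ehrlichMap_sub_le hn hf hdeg hb h i
  have h2' := norm_ehrlichMap_sub_le hn hf hdeg hb h j
  have h3 := norm_weierstrass_le hn h hij
  have h3' := norm_weierstrass_le hn h hij.symm
  rw [norm_sub_rev] at h3'
  have h4 := mul_le_mul_of_nonneg_right (h.pair i j hij) (norm_nonneg (z i - z j))
  have h5 : ‖z i - z j‖ ≤ ‖ehrlichMap f z i - ehrlichMap f z j‖ +
      ‖ehrlichMap f z i - z i‖ + ‖ehrlichMap f z j - z j‖ := by
    have e : z i - z j = (ehrlichMap f z i - ehrlichMap f z j) -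
      (ehrlichMap f z i - z i) + (ehrlichMap f z j - z j) := by ring
    calc ‖z i - z j‖ = _ := congrArg norm e
      _ ≤ _ := (norm_add_le _ _).trans (add_le_add_left (norm_sub_le _ _) _)
  have h6 : mu a x * (‖weierstrass f z i‖ + ‖weierstrass f z j‖) ≤
      mu a x * (b * x * ‖z i - z j‖) := by
    refine mul_le_mul_of_nonneg_left ?_ (one_div_pos.2 h1).le
    linarith
  have h7 : psi a b x = 1 - mu a x * (b * x) := by
    rw [mu, psi]; field_simp; ring
  rw [h7]
  linarith

lemma injective_ehrlichMap (hn : 2 ≤ n) (hf : f.Monic) (hdeg : f.natDegree = n) (hb : 1 ≤ b)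
    (h : StepBound f a b x z) : Function.Injective (ehrlichMap f z) := by
  intro i j hij
  by_contra hne
  have h1 := psi_mul_norm_sub_le hn hf hdeg hb h (Ne.symm hne)
  rw [hij, sub_self, norm_zero] at h1
  exact absurd h1 (not_le.2 (mul_pos (psi_pos hb h.nonneg h.lt_one)
    (norm_sub_pos h (Ne.symm hne))))

lemma psi_mul_sep_le (hn : 2 ≤ n) (hf : f.Monic) (hdeg : f.natDegree = n) (hb : 1 ≤ b)
    (h : StepBound f a b x z) (i : Fin n) :
    psi a b x * sep z i ≤ sep (ehrlichMap f z) i :=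
  le_sep hn _ i fun _ hj => (mul_le_mul_of_nonneg_left (sep_le z hj)
    (psi_pos hb h.nonneg h.lt_one).le).trans (psi_mul_norm_sub_le hn hf hdeg hb h hj)

/-- The new value of the polynomial: the two leading terms of Lagrange's formula cancel by the
choice of the step, which leaves the square of the step and one more factor `W`. -/
lemma eval_ehrlichMap (hn : 2 ≤ n) (hf : f.Monic) (hdeg : f.natDegree = n) (hb : 1 ≤ b)
    (h : StepBound f a b x z) (i : Fin n) :
    f.eval (ehrlichMap f z i) =
      -((ehrlichMap f z i - z i) ^ 2 *
        ∑ j ∈ Finset.univ.erase i,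
          weierstrass f z j / ((ehrlichMap f z i - z j) * (z i - z j))) *
      ∏ j ∈ Finset.univ.erase i, (ehrlichMap f z i - z j) := by
  obtain ⟨h1, h2, -⟩ := one_sub_pos_of_gauge hb h.nonneg h.lt_one
  have hne : ∀ j, j ≠ i → ehrlichMap f z i ≠ z j := fun j hj e => by
    have := (mul_pos (div_pos h2 h1) (norm_sub_pos h hj)).trans_le
      (norm_ehrlichMap_sub_ge hn hf hdeg hb h hj)
    rw [e, sub_self, norm_zero] at this
    exact this.false
  have hstep := ehrlichMap_sub_mul hn hf hdeg hb h i
  have hsum : ∑ j ∈ Finset.univ.erase i, weierstrass f z j / (ehrlichMap f z i - z j) =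
      ∑ j ∈ Finset.univ.erase i, weierstrass f z j / (z i - z j) -
      (ehrlichMap f z i - z i) * ∑ j ∈ Finset.univ.erase i,
          weierstrass f z j / ((ehrlichMap f z i - z j) * (z i - z j)) := by
    rw [Finset.mul_sum, ← Finset.sum_sub_distrib]
    refine Finset.sum_congr rfl fun j hj => ?_
    have hji := Finset.ne_of_mem_erase hj
    have h3 := sub_ne_zero.2 (hne j hji)
    have h4 : z i - z j ≠ 0 := norm_pos_iff.1 (norm_sub_pos h hji)
    field_simp
    ring
  rw [eval_eq_prod_mul hf hdeg h.injective i hne, hsum]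
  linear_combination (∏ j ∈ Finset.univ.erase i, (ehrlichMap f z i - z j)) * hstep

/-- One step shrinks every Weierstrass correction by the factor `ψ φ`. The product of the
quotients `(z'_i - z_j) / (z'_i - z'_j)` is bounded by the inequality of the means. -/
lemma norm_weierstrass_ehrlichMap_le (hn : 2 ≤ n) (hf : f.Monic) (hdeg : f.natDegree = n)
    (ha : 0 ≤ a) (hb : 1 ≤ b) (h : StepBound f a b x z) (i : Fin n) :
    ‖weierstrass f (ehrlichMap f z) i‖ ≤ psi a b x * phi n a b x * ‖weierstrass f z i‖ := by
  obtain ⟨h1, h2, h3⟩ := one_sub_pos_of_gauge hb h.nonneg h.lt_one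
  have hx0 := h.nonneg
  have hmu : 0 < mu a x := one_div_pos.2 h1
  have hpsi := psi_pos hb h.nonneg h.lt_one
  have hn' : (2 : ℝ) ≤ n := by exact_mod_cast hn
  set z' := ehrlichMap f z with hz'
  have hstep := norm_ehrlichMap_sub_le hn hf hdeg hb h
  have hprod : ‖∏ j ∈ Finset.univ.erase i, (z' i - z j) / (z' i - z' j)‖ ≤
      (1 + 1 / ((n : ℝ) - 1) * (a * x / (1 - (a + b) * x))) ^ (n - 1) := by
    have hcard : (Finset.univ.erase i).card = n - 1 := by
      rw [Finset.card_erase_of_mem (Finset.mem_univ i), Finset.card_univ, Fintype.card_fin]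
    have hcast : ((n - 1 : ℕ) : ℝ) = (n : ℝ) - 1 := by
      rw [Nat.cast_sub (by omega), Nat.cast_one]
    rw [norm_prod]
    refine (prod_le_arith_mean_pow _ _ fun j _ => norm_nonneg _).trans ?_
    rw [hcard, hcast]
    refine pow_le_pow_left₀ (div_nonneg (Finset.sum_nonneg fun j _ => norm_nonneg _)
      (by linarith)) ?_ _
    have hterm : ∀ j ∈ Finset.univ.erase i, ‖(z' i - z j) / (z' i - z' j)‖ ≤
        1 + 1 / (1 - (a + b) * x) * (‖weierstrass f z j‖ / sep z j) := by
      intro j hj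
      have hji := Finset.ne_of_mem_erase hj
      have hpos := norm_sub_pos h hji
      have hsep := psi_mul_norm_sub_le hn hf hdeg hb h hji
      have hpos' : 0 < ‖z' i - z' j‖ := (mul_pos hpsi hpos).trans_le hsep
      have e : (z' i - z j) / (z' i - z' j) = 1 + (z' j - z j) / (z' i - z' j) := by
        have : z' i - z' j ≠ 0 := norm_pos_iff.1 hpos'
        field_simp
        ring
      rw [e]
      refine (norm_add_le _ _).trans ?_
      rw [norm_one, norm_div]
      refine add_le_add_right ?_ 1
      have hj' := norm_weierstrass_le hn h hji.symm
      rw [norm_sub_rev] at hj'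
      have hW : 0 ≤ ‖weierstrass f z j‖ / sep z j :=
        div_nonneg (norm_nonneg _) (sep_pos hn h.injective j).le
      rw [div_le_iff₀ hpos']
      calc ‖z' j - z j‖ ≤ mu a x * (‖weierstrass f z j‖ / sep z j * ‖z i - z j‖) :=
            (hstep j).trans (mul_le_mul_of_nonneg_left hj' hmu.le)
        _ = 1 / (1 - (a + b) * x) * (‖weierstrass f z j‖ / sep z j) *
              (psi a b x * ‖z i - z j‖) := by
            have h3' : 1 - x * (a + b) ≠ 0 := by rw [mul_comm]; exact h3.ne'
            rw [mu, psi]; field_simp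
        _ ≤ _ := mul_le_mul_of_nonneg_left hsep (mul_nonneg (one_div_pos.2 h3).le hW)
    have hsum := Finset.sum_le_sum hterm
    rw [Finset.sum_add_distrib, Finset.sum_const, hcard, nsmul_eq_mul, mul_one, hcast,
      ← Finset.mul_sum] at hsum
    have h5 := mul_le_mul_of_nonneg_left (h.erase i) (one_div_pos.2 h3).le
    rw [div_le_iff₀ (by linarith)]
    have hn1 : (n : ℝ) - 1 ≠ 0 := by linarith
    have e : (1 + 1 / ((n : ℝ) - 1) * (a * x / (1 - (a + b) * x))) * ((n : ℝ) - 1) =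
        (n : ℝ) - 1 + 1 / (1 - (a + b) * x) * (a * x) := by
      field_simp
    rw [e]
    linarith
  have hfirst : ‖(z' i - z i) ^ 2 * ∑ j ∈ Finset.univ.erase i,
      weierstrass f z j / ((z' i - z j) * (z i - z j))‖ ≤
      a * x ^ 2 / ((1 - (a + 1) * x) * (1 - a * x)) * ‖weierstrass f z i‖ := by
    have hdi := sep_pos hn h.injective i
    have hc : 0 < (1 - (a + 1) * x) / (1 - a * x) := div_pos h2 h1
    have hterm : ∀ j ∈ Finset.univ.erase i,
        ‖weierstrass f z j / ((z' i - z j) * (z i - z j))‖ ≤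
        1 / ((1 - (a + 1) * x) / (1 - a * x) * sep z i) *
          (‖weierstrass f z j‖ / sep z j) := by
      intro j hj
      have hji := Finset.ne_of_mem_erase hj
      have hdj := sep_pos hn h.injective j
      have h5 := norm_ehrlichMap_sub_ge hn hf hdeg hb h hji
      have h6 : sep z j ≤ ‖z i - z j‖ := by
        rw [norm_sub_rev]; exact sep_le z hji.symm
      rw [norm_div, norm_mul, one_div_mul_eq_div, div_div, mul_comm (sep z j)]
      refine div_le_div_of_nonneg_left (norm_nonneg _) (by positivity) ?_
      exact mul_le_mul ((mul_le_mul_of_nonneg_left (sep_le z hji) hc.le).trans h5) h6 hdj.le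
        (norm_nonneg _)
    have hsum : ‖∑ j ∈ Finset.univ.erase i, weierstrass f z j / ((z' i - z j) * (z i - z j))‖ ≤
        1 / ((1 - (a + 1) * x) / (1 - a * x) * sep z i) * (a * x) := by
      refine (norm_sum_le _ _).trans ((Finset.sum_le_sum hterm).trans ?_)
      rw [← Finset.mul_sum]
      exact mul_le_mul_of_nonneg_left (h.erase i) (by positivity)
    have hWi : ‖weierstrass f z i‖ ≤ x * sep z i := (div_le_iff₀ hdi).1 (h.single i)
    rw [norm_mul, norm_pow]
    calc ‖z' i - z i‖ ^ 2 * _ ≤ (mu a x * ‖weierstrass f z i‖) ^ 2 *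
          (1 / ((1 - (a + 1) * x) / (1 - a * x) * sep z i) * (a * x)) := by
          gcongr
          exact hstep i
      _ = mu a x ^ 2 * (1 / ((1 - (a + 1) * x) / (1 - a * x) * sep z i) * (a * x)) *
          ‖weierstrass f z i‖ * ‖weierstrass f z i‖ := by ring
      _ ≤ mu a x ^ 2 * (1 / ((1 - (a + 1) * x) / (1 - a * x) * sep z i) * (a * x)) *
          (x * sep z i) * ‖weierstrass f z i‖ := by
          gcongr
      _ = _ := by
          rw [mu]; field_simp
  have hval : weierstrass f z' i = -((z' i - z i) ^ 2 * ∑ j ∈ Finset.univ.erase i,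
      weierstrass f z j / ((z' i - z j) * (z i - z j))) *
      ∏ j ∈ Finset.univ.erase i, (z' i - z j) / (z' i - z' j) := by
    rw [weierstrass, hz', eval_ehrlichMap hn hf hdeg hb h i, ← hz', Finset.prod_div_distrib,
      mul_div_assoc]
  rw [hval, norm_mul, norm_neg, psi_mul_phi_eq n h.lt_one, psiPhiFactor]
  calc _ ≤ a * x ^ 2 / ((1 - (a + 1) * x) * (1 - a * x)) * ‖weierstrass f z i‖ *
        (1 + 1 / ((n : ℝ) - 1) * (a * x / (1 - (a + b) * x))) ^ (n - 1) := by
        gcongr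
    _ = _ := by ring

end Step

/-- One step multiplies `E` by at most `φ(E)`. -/
lemma E_ehrlichMap_le {n : ℕ} (hn : 2 ≤ n) {f : Polynomial ℂ} (hf : f.Monic)
    (hdeg : f.natDegree = n) {p : ℝ≥0∞} (hp : 1 ≤ p) {a b : ℝ} (ha : 0 ≤ a) (hb : 1 ≤ b)
    {z : Fin n → ℂ} (h : StepBound f a b (E p f z) z) :
    E p f (ehrlichMap f z) ≤ phi n a b (E p f z) * E p f z := by
  have hphi := phi_nonneg hn ha hb h.nonneg h.lt_one
  have hpsi := psi_pos hb h.nonneg h.lt_one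
  refine pNorm_le_mul_of_norm_le hp hphi fun i => ?_
  have h1 := sep_pos hn h.injective i
  have h2 := psi_mul_sep_le hn hf hdeg hb h i
  have h3 : 0 < sep (ehrlichMap f z) i := (mul_pos hpsi h1).trans_le h2
  rw [norm_div, norm_div, Complex.norm_real, Complex.norm_real, Real.norm_of_nonneg h1.le,
    Real.norm_of_nonneg h3.le]
  calc _ ≤ psi a b (E p f z) * phi n a b (E p f z) * ‖weierstrass f z i‖ /
        (psi a b (E p f z) * sep z i) := by
        gcongr
        exact norm_weierstrass_ehrlichMap_le hn hf hdeg ha hb h i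
    _ = _ := by field_simp

/-! ### The whole sequence -/

/-- The standing assumptions: `f` is monic of degree `n ≥ 2`, the exponents `p` and `q` are
conjugate, `a = (n - 1)^(1/q)` and `b = 2^(1/q)`. -/
structure Setting (n : ℕ) (f : Polynomial ℂ) (p q : ℝ≥0∞) (a b : ℝ) : Prop where
  two_le : 2 ≤ n
  monic : f.Monic
  natDegree_eq : f.natDegree = n
  one_le : 1 ≤ p
  conj : 1 / p + 1 / q = 1
  a_eq : a = ((n : ℝ) - 1) ^ (1 / q).toReal
  b_eq : b = (2 : ℝ) ^ (1 / q).toReal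

/-- The initial condition: distinct components, `E(z) < 1 / (a + b)` and `φ(E(z)) ≤ 1`. -/
structure Admissible {n : ℕ} (f : Polynomial ℂ) (p : ℝ≥0∞) (a b : ℝ) (z : Fin n → ℂ) : Prop where
  injective : Function.Injective z
  lt_one : (a + b) * E p f z < 1
  phi_le_one : phi n a b (E p f z) ≤ 1

section Sequence

variable {n : ℕ} {f : Polynomial ℂ} {p q : ℝ≥0∞} {a b : ℝ} {z : Fin n → ℂ}

lemma Setting.a_nonneg (S : Setting n f p q a b) : 0 ≤ a := by
  have : (2 : ℝ) ≤ n := by exact_mod_cast S.two_le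
  rw [S.a_eq]
  exact Real.rpow_nonneg (by linarith) _

lemma Setting.one_le_b (S : Setting n f p q a b) : 1 ≤ b := by
  rw [S.b_eq]
  exact Real.one_le_rpow one_le_two ENNReal.toReal_nonneg

lemma Setting.stepBound (S : Setting n f p q a b) (h : Admissible f p a b z) :
    StepBound f a b (E p f z) z :=
  stepBound_E S.two_le S.one_le S.conj S.a_eq S.b_eq h.injective h.lt_one

lemma Setting.phi_nonneg (S : Setting n f p q a b) (h : Admissible f p a b z) :
    0 ≤ phi n a b (E p f z) :=
  Ehrlich.phi_nonneg S.two_le S.a_nonneg S.one_le_b (E_nonneg S.one_le f z) h.lt_one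

lemma Setting.psi_pos (S : Setting n f p q a b) (h : Admissible f p a b z) :
    0 < psi a b (E p f z) :=
  Ehrlich.psi_pos S.one_le_b (E_nonneg S.one_le f z) h.lt_one

lemma Setting.psi_mul_phi_lt_one (S : Setting n f p q a b) (h : Admissible f p a b z) :
    psi a b (E p f z) * phi n a b (E p f z) < 1 :=
  Ehrlich.psi_mul_phi_lt_one S.one_le_b (E_nonneg S.one_le f z) h.lt_one h.phi_le_one

lemma Setting.mu_pos (S : Setting n f p q a b) (h : Admissible f p a b z) :
    0 < mu a (E p f z) :=
  (mu_mono S.a_nonneg S.one_le_b (E_nonneg S.one_le f z) le_rfl h.lt_one).1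

lemma Setting.E_ehrlichMap_le (S : Setting n f p q a b) (h : Admissible f p a b z) :
    E p f (ehrlichMap f z) ≤ phi n a b (E p f z) * E p f z :=
  Ehrlich.E_ehrlichMap_le S.two_le S.monic S.natDegree_eq S.one_le S.a_nonneg S.one_le_b
    (S.stepBound h)

/-- The initial condition is preserved, and `φ ∘ E` is cubed, in one step. -/
lemma Setting.admissible_ehrlichMap (S : Setting n f p q a b) (h : Admissible f p a b z) :
    Admissible f p a b (ehrlichMap f z) ∧
      phi n a b (E p f (ehrlichMap f z)) ≤ phi n a b (E p f z) ^ 3 := by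
  have h0 := E_nonneg S.one_le f z
  have h1 := S.E_ehrlichMap_le h
  have h2 := S.phi_nonneg h
  have ha := S.a_nonneg
  have hb := S.one_le_b
  have h3 : E p f (ehrlichMap f z) ≤ E p f z := h1.trans (by nlinarith [h.phi_le_one])
  have h4 := phi_le_sq_mul S.two_le ha hb (E_nonneg S.one_le f _) h0 h.phi_le_one h1 h.lt_one
  have h5 : phi n a b (E p f (ehrlichMap f z)) ≤ phi n a b (E p f z) ^ 3 :=
    h4.trans_eq (by ring)
  refine ⟨⟨injective_ehrlichMap S.two_le S.monic S.natDegree_eq hb (S.stepBound h), ?_,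
    h5.trans (pow_le_one₀ h2 h.phi_le_one)⟩, h5⟩
  exact (mul_le_mul_of_nonneg_left h3 (by linarith)).trans_lt h.lt_one

lemma Setting.admissible_seq (S : Setting n f p q a b) (h : Admissible f p a b z) (k : ℕ) :
    Admissible f p a b (ehrlichSeq f z k) := by
  induction k with
  | zero => exact h
  | succ k ih => exact (S.admissible_ehrlichMap ih).1

lemma Setting.phi_E_seq_le (S : Setting n f p q a b) (h : Admissible f p a b z) (k : ℕ) :
    phi n a b (E p f (ehrlichSeq f z k)) ≤ phi n a b (E p f z) ^ 3 ^ k := by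
  induction k with
  | zero => simp [ehrlichSeq]
  | succ k ih =>
    have hk := S.admissible_seq h k
    refine (S.admissible_ehrlichMap hk).2.trans ?_
    rw [pow_succ 3, pow_mul]
    exact pow_le_pow_left₀ (S.phi_nonneg hk) ih 3

lemma three_pow_succ_sub_one_div_two (k : ℕ) :
    (3 ^ (k + 1) - 1) / 2 = (3 ^ k - 1) / 2 + 3 ^ k := by
  have : 0 < 3 ^ k := by positivity
  have h2 : 3 ^ k % 2 = 1 := by simp [Nat.pow_mod]
  omega

lemma two_mul_three_pow_sub_one_div_two (k : ℕ) : (3 ^ k - 1) / 2 * 2 + 1 = 3 ^ k := by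
  have : 0 < 3 ^ k := by positivity
  have h2 : 3 ^ k % 2 = 1 := by simp [Nat.pow_mod]
  omega

lemma Setting.E_seq_le (S : Setting n f p q a b) (h : Admissible f p a b z) (k : ℕ) :
    E p f (ehrlichSeq f z k) ≤ phi n a b (E p f z) ^ ((3 ^ k - 1) / 2) * E p f z := by
  induction k with
  | zero => simp [ehrlichSeq]
  | succ k ih =>
    have hk := S.admissible_seq h k
    refine (S.E_ehrlichMap_le hk).trans ?_
    rw [three_pow_succ_sub_one_div_two, pow_add, mul_right_comm, mul_comm]
    exact mul_le_mul ih (S.phi_E_seq_le h k) (S.phi_nonneg hk)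
      (mul_nonneg (pow_nonneg (S.phi_nonneg h) _) (E_nonneg S.one_le f z))

lemma Setting.E_seq_le_E (S : Setting n f p q a b) (h : Admissible f p a b z) (k : ℕ) :
    E p f (ehrlichSeq f z k) ≤ E p f z :=
  (S.E_seq_le h k).trans (mul_le_of_le_one_left (E_nonneg S.one_le f z)
    (pow_le_one₀ (S.phi_nonneg h) h.phi_le_one))

/-- Quasi-homogeneity of `ψ φ` along the sequence. It is this bound on the product, rather than
separate bounds on `ψ` and `φ`, that yields the powers of `θ` in the a priori estimate. -/
lemma Setting.psi_mul_phi_seq_le (S : Setting n f p q a b) (h : Admissible f p a b z) (k : ℕ) :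
    psi a b (E p f (ehrlichSeq f z k)) * phi n a b (E p f (ehrlichSeq f z k)) ≤
      psi a b (E p f z) * phi n a b (E p f z) ^ 3 ^ k := by
  refine (psi_mul_phi_le_sq_mul S.two_le S.a_nonneg S.one_le_b (E_nonneg S.one_le f _)
    (E_nonneg S.one_le f z) (pow_le_one₀ (S.phi_nonneg h) h.phi_le_one) (S.E_seq_le h k)
    h.lt_one).trans_eq ?_
  conv_rhs => rw [← two_mul_three_pow_sub_one_div_two k, pow_succ, pow_mul]
  ring

lemma Setting.norm_weierstrass_seq_succ_le (S : Setting n f p q a b) (h : Admissible f p a b z)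
    (k : ℕ) (i : Fin n) :
    ‖weierstrass f (ehrlichSeq f z (k + 1)) i‖ ≤
      psi a b (E p f (ehrlichSeq f z k)) * phi n a b (E p f (ehrlichSeq f z k)) *
        ‖weierstrass f (ehrlichSeq f z k) i‖ :=
  norm_weierstrass_ehrlichMap_le S.two_le S.monic S.natDegree_eq S.a_nonneg S.one_le_b
    (S.stepBound (S.admissible_seq h k)) i

lemma Setting.norm_weierstrass_seq_le (S : Setting n f p q a b) (h : Admissible f p a b z)
    (k : ℕ) (i : Fin n) :
    ‖weierstrass f (ehrlichSeq f z k) i‖ ≤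
      psi a b (E p f z) ^ k * phi n a b (E p f z) ^ ((3 ^ k - 1) / 2) *
        ‖weierstrass f z i‖ := by
  induction k with
  | zero => simp [ehrlichSeq]
  | succ k ih =>
    refine (S.norm_weierstrass_seq_succ_le h k i).trans ?_
    have h1 := S.psi_pos h
    have h2 := S.phi_nonneg h
    rw [three_pow_succ_sub_one_div_two]
    refine (mul_le_mul (S.psi_mul_phi_seq_le h k) ih (norm_nonneg _) (by positivity)).trans_eq ?_
    ring

lemma Setting.norm_weierstrass_seq_le_geometric (S : Setting n f p q a b)
    (h : Admissible f p a b z) (k : ℕ) (i : Fin n) :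
    ‖weierstrass f (ehrlichSeq f z k) i‖ ≤
      (psi a b (E p f z) * phi n a b (E p f z)) ^ k * ‖weierstrass f z i‖ := by
  induction k with
  | zero => simp [ehrlichSeq]
  | succ k ih =>
    refine (S.norm_weierstrass_seq_succ_le h k i).trans ?_
    have h1 := S.psi_pos h
    have h2 := S.phi_nonneg h
    have h3 : psi a b (E p f (ehrlichSeq f z k)) * phi n a b (E p f (ehrlichSeq f z k)) ≤
        psi a b (E p f z) * phi n a b (E p f z) :=
      (S.psi_mul_phi_seq_le h k).trans (mul_le_mul_of_nonneg_left
        (pow_le_of_le_one h2 h.phi_le_one (by positivity)) h1.le)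
    refine (mul_le_mul h3 ih (norm_nonneg _) (by positivity)).trans_eq ?_
    ring

lemma Setting.dist_seq_succ_le (S : Setting n f p q a b) (h : Admissible f p a b z) (k : ℕ)
    (i : Fin n) :
    dist (ehrlichSeq f z k i) (ehrlichSeq f z (k + 1) i) ≤
      mu a (E p f z) * ‖weierstrass f z i‖ * (psi a b (E p f z) * phi n a b (E p f z)) ^ k := by
  have hk := S.admissible_seq h k
  rw [dist_comm, dist_eq_norm]
  refine (norm_ehrlichMap_sub_le S.two_le S.monic S.natDegree_eq S.one_le_b (S.stepBound hk)
    i).trans ?_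
  obtain ⟨-, h1⟩ := mu_mono S.a_nonneg S.one_le_b (E_nonneg S.one_le f _) (S.E_seq_le_E h k)
    h.lt_one
  refine (mul_le_mul h1 (S.norm_weierstrass_seq_le_geometric h k i) (norm_nonneg _)
    (S.mu_pos h).le).trans_eq ?_
  ring

lemma Setting.exists_tendsto (S : Setting n f p q a b) (h : Admissible f p a b z) :
    ∃ ξ, Filter.Tendsto (ehrlichSeq f z) Filter.atTop (nhds ξ) := by
  have hc : ∀ i, ∃ x, Filter.Tendsto (fun k => ehrlichSeq f z k i) Filter.atTop (nhds x) :=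
    fun i => cauchySeq_tendsto_of_complete
      (cauchySeq_of_le_geometric _ _ (S.psi_mul_phi_lt_one h) fun k => S.dist_seq_succ_le h k i)
  choose ξ hξ using hc
  exact ⟨ξ, tendsto_pi_nhds.2 hξ⟩

lemma ehrlichSeq_add (f : Polynomial ℂ) (z : Fin n → ℂ) (k m : ℕ) :
    ehrlichSeq f (ehrlichSeq f z k) m = ehrlichSeq f z (k + m) := by
  induction m with
  | zero => rfl
  | succ m ih => rw [ehrlichSeq, ih]; rfl

/-- The a posteriori estimate, componentwise: the steps that follow the `k`-th one are dominated
by a geometric series of ratio `ψ(E(z^k)) φ(E(z^k))`. -/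
lemma Setting.norm_seq_sub_le (S : Setting n f p q a b) (h : Admissible f p a b z)
    {ξ : Fin n → ℂ} (hξ : Filter.Tendsto (ehrlichSeq f z) Filter.atTop (nhds ξ)) (k : ℕ)
    (i : Fin n) :
    ‖ehrlichSeq f z k i - ξ i‖ ≤
      mu a (E p f (ehrlichSeq f z k)) / (1 - psi a b (E p f (ehrlichSeq f z k)) *
        phi n a b (E p f (ehrlichSeq f z k))) * ‖weierstrass f (ehrlichSeq f z k) i‖ := by
  have hk := S.admissible_seq h k
  have hlim : Filter.Tendsto (fun m => ehrlichSeq f (ehrlichSeq f z k) m i) Filter.atTop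
      (nhds (ξ i)) := by
    simp only [ehrlichSeq_add]
    have := (tendsto_pi_nhds.1 hξ i).comp (Filter.tendsto_add_atTop_nat k)
    simpa only [Function.comp_def, add_comm] using this
  have h1 := dist_le_of_le_geometric_of_tendsto₀ _ _ (S.psi_mul_phi_lt_one hk)
    (fun m => S.dist_seq_succ_le hk m i) hlim
  rw [dist_eq_norm] at h1
  exact h1.trans_eq (by ring)

lemma Setting.pNorm_seq_sub_le (S : Setting n f p q a b) (h : Admissible f p a b z)
    {ξ : Fin n → ℂ} (hξ : Filter.Tendsto (ehrlichSeq f z) Filter.atTop (nhds ξ)) (k : ℕ) :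
    pNorm p (ehrlichSeq f z k - ξ) ≤
      mu a (E p f (ehrlichSeq f z k)) / (1 - psi a b (E p f (ehrlichSeq f z k)) *
        phi n a b (E p f (ehrlichSeq f z k))) * pNorm p (weierstrass f (ehrlichSeq f z k)) := by
  have hk := S.admissible_seq h k
  exact pNorm_le_mul_of_norm_le S.one_le
    (div_nonneg (S.mu_pos hk).le (sub_nonneg.2 (S.psi_mul_phi_lt_one hk).le))
    (S.norm_seq_sub_le h hξ k)

lemma Setting.psi_mul_phi_pow_lt_one (S : Setting n f p q a b) (h : Admissible f p a b z)
    (k : ℕ) : psi a b (E p f z) * phi n a b (E p f z) ^ 3 ^ k < 1 :=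
  (mul_le_mul_of_nonneg_left (pow_le_of_le_one (S.phi_nonneg h) h.phi_le_one (by positivity))
    (S.psi_pos h).le).trans_lt (S.psi_mul_phi_lt_one h)

/-- The a priori estimate, from the a posteriori one and the decay of `E`, `ψ φ` and `W`. -/
lemma Setting.pNorm_seq_sub_le_apriori (S : Setting n f p q a b) (h : Admissible f p a b z)
    {ξ : Fin n → ℂ} (hξ : Filter.Tendsto (ehrlichSeq f z) Filter.atTop (nhds ξ)) (k : ℕ) :
    pNorm p (ehrlichSeq f z k - ξ) ≤
      mu a (E p f z * phi n a b (E p f z) ^ ((3 ^ k - 1) / 2)) *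
        (psi a b (E p f z) ^ k * phi n a b (E p f z) ^ ((3 ^ k - 1) / 2) /
          (1 - psi a b (E p f z) * phi n a b (E p f z) ^ 3 ^ k)) *
        pNorm p (weierstrass f z) := by
  have hk := S.admissible_seq h k
  have h1 := S.phi_nonneg h
  have h2 := S.psi_pos h
  have h3 := S.psi_mul_phi_pow_lt_one h k
  have hE0 := E_nonneg S.one_le f z
  have h4 : (a + b) * (E p f z * phi n a b (E p f z) ^ ((3 ^ k - 1) / 2)) < 1 := by
    refine (mul_le_mul_of_nonneg_left (mul_le_of_le_one_right hE0
      (pow_le_one₀ h1 h.phi_le_one)) ?_).trans_lt h.lt_one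
    linarith [S.a_nonneg, S.one_le_b]
  have hEk := S.E_seq_le h k
  rw [mul_comm] at hEk
  obtain ⟨h5, h6⟩ := mu_mono S.a_nonneg S.one_le_b (E_nonneg S.one_le f _) hEk h4
  have hW : pNorm p (weierstrass f (ehrlichSeq f z k)) ≤
      psi a b (E p f z) ^ k * phi n a b (E p f z) ^ ((3 ^ k - 1) / 2) *
        pNorm p (weierstrass f z) :=
    pNorm_le_mul_of_norm_le S.one_le (by positivity) (S.norm_weierstrass_seq_le h k)
  refine (S.pNorm_seq_sub_le h hξ k).trans ((mul_le_mul (div_le_div₀ (h5.le.trans h6) h6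
    (sub_pos.2 h3) (sub_le_sub_left (S.psi_mul_phi_seq_le h k) 1)) hW
    (pNorm_nonneg S.one_le _) (div_nonneg (h5.le.trans h6) (sub_pos.2 h3).le)).trans_eq ?_)
  ring

lemma Setting.tendsto_weierstrass_seq (S : Setting n f p q a b) (h : Admissible f p a b z)
    (i : Fin n) :
    Filter.Tendsto (fun k => weierstrass f (ehrlichSeq f z k) i) Filter.atTop (nhds 0) := by
  refine squeeze_zero_norm (S.norm_weierstrass_seq_le_geometric h · i) ?_
  have := (tendsto_pow_atTop_nhds_zero_of_lt_one
    (mul_nonneg (S.psi_pos h).le (S.phi_nonneg h)) (S.psi_mul_phi_lt_one h)).mul_const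
    ‖weierstrass f z i‖
  simpa using this

/-- Since the corrections tend to zero, Lagrange's formula becomes `f(x) = ∏ (x - ξ_j)` in the
limit, which counts multiplicities correctly. -/
lemma Setting.eq_prod_X_sub_C (S : Setting n f p q a b) (h : Admissible f p a b z)
    {ξ : Fin n → ℂ} (hξ : Filter.Tendsto (ehrlichSeq f z) Filter.atTop (nhds ξ)) :
    f = ∏ j, (Polynomial.X - Polynomial.C (ξ j)) := by
  have hξ' := tendsto_pi_nhds.1 hξ
  have hprod : ∀ (s : Finset (Fin n)) (x : ℂ), Filter.Tendsto
      (fun k => ∏ j ∈ s, (x - ehrlichSeq f z k j)) Filter.atTop (nhds (∏ j ∈ s, (x - ξ j))) :=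
    fun s x => tendsto_finsetProd s fun j _ => (hξ' j).const_sub x
  refine Polynomial.funext fun x => ?_
  rw [Polynomial.eval_prod]
  simp only [Polynomial.eval_sub, Polynomial.eval_X, Polynomial.eval_C]
  have hlim := (hprod Finset.univ x).add (tendsto_finsetSum Finset.univ fun j _ =>
    (S.tendsto_weierstrass_seq h j).mul (hprod (Finset.univ.erase j) x))
  have hconst : ∀ k, ∏ j, (x - ehrlichSeq f z k j) + ∑ j, weierstrass f (ehrlichSeq f z k) j *
      ∏ l ∈ Finset.univ.erase j, (x - ehrlichSeq f z k l) = f.eval x := by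
    intro k
    conv_rhs => rw [eq_nodal_add_sum S.monic S.natDegree_eq (S.admissible_seq h k).injective]
    rw [Polynomial.eval_add, Polynomial.eval_finsetSum, Lagrange.eval_nodal]
    simp only [Polynomial.eval_C_mul, Lagrange.eval_nodal]
  simp only [hconst, zero_mul, Finset.sum_const_zero, add_zero] at hlim
  exact tendsto_nhds_unique tendsto_const_nhds hlim

lemma Setting.isRootVector (S : Setting n f p q a b) (h : Admissible f p a b z)
    {ξ : Fin n → ℂ} (hξ : Filter.Tendsto (ehrlichSeq f z) Filter.atTop (nhds ξ)) :
    IsRootVector f ξ := by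
  have hroots := Polynomial.roots_multiset_prod_X_sub_C (Finset.univ.val.map ξ)
  rw [Multiset.map_map] at hroots
  rw [IsRootVector, S.eq_prod_X_sub_C h hξ]
  exact hroots

/-! ### Cubic order of convergence -/

lemma Setting.tendsto_E_seq (S : Setting n f p q a b) (h : Admissible f p a b z)
    (hlam : phi n a b (E p f z) < 1) :
    Filter.Tendsto (fun k => E p f (ehrlichSeq f z k)) Filter.atTop (nhds 0) := by
  have hexp : ∀ k, k ≤ (3 ^ k - 1) / 2 := by
    intro k
    induction k with
    | zero => simp
    | succ k ih =>
      rw [three_pow_succ_sub_one_div_two]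
      exact add_le_add ih (Nat.one_le_pow _ _ (by norm_num))
  refine squeeze_zero (fun k => E_nonneg S.one_le f _) (fun k => (S.E_seq_le h k).trans
    (mul_le_mul_of_nonneg_right (pow_le_pow_of_le_one (S.phi_nonneg h) h.phi_le_one (hexp k))
      (E_nonneg S.one_le f z))) ?_
  simpa using (tendsto_pow_atTop_nhds_zero_of_lt_one (S.phi_nonneg h) hlam).mul_const (E p f z)

/-- The a posteriori estimate with a constant that does not depend on `k`. -/
lemma Setting.norm_seq_sub_le_const (S : Setting n f p q a b) (h : Admissible f p a b z)
    {ξ : Fin n → ℂ} (hξ : Filter.Tendsto (ehrlichSeq f z) Filter.atTop (nhds ξ)) :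
    ∃ M, 0 < M ∧ ∀ k i,
      ‖ehrlichSeq f z k i - ξ i‖ ≤ M * ‖weierstrass f (ehrlichSeq f z k) i‖ := by
  have h1 := S.psi_mul_phi_lt_one h
  refine ⟨mu a (E p f z) / (1 - psi a b (E p f z) * phi n a b (E p f z)),
    div_pos (S.mu_pos h) (sub_pos.2 h1), fun k i => (S.norm_seq_sub_le h hξ k i).trans ?_⟩
  have h2 := (mu_mono S.a_nonneg S.one_le_b (E_nonneg S.one_le f _) (S.E_seq_le_E h k)
    h.lt_one).2
  have h3 := (S.psi_mul_phi_seq_le h k).trans (mul_le_mul_of_nonneg_left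
    (pow_le_of_le_one (S.phi_nonneg h) h.phi_le_one (by positivity)) (S.psi_pos h).le)
  exact mul_le_mul_of_nonneg_right (div_le_div₀ (S.mu_pos h).le h2 (sub_pos.2 h1)
    (sub_le_sub_left h3 1)) (norm_nonneg _)

/-- For `λ < 1` the limit has distinct components: otherwise the a posteriori estimate would give
`|z^k_i - z^k_j| ≤ M b E(z^k) |z^k_i - z^k_j|` with `E(z^k) → 0`. -/
lemma Setting.injective_limit (S : Setting n f p q a b) (h : Admissible f p a b z)
    (hlam : phi n a b (E p f z) < 1)
    {ξ : Fin n → ℂ} (hξ : Filter.Tendsto (ehrlichSeq f z) Filter.atTop (nhds ξ)) :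
    Function.Injective ξ := by
  intro i j hij
  by_contra hne
  obtain ⟨M, hM, hMk⟩ := S.norm_seq_sub_le_const h hξ
  have hlim := (S.tendsto_E_seq h hlam).const_mul (M * b)
  rw [mul_zero] at hlim
  obtain ⟨k, hk⟩ := (hlim.eventually (gt_mem_nhds one_pos)).exists
  have hB := S.stepBound (S.admissible_seq h k)
  have h1 := hMk k i
  have h2 := hMk k j
  have h3 := norm_weierstrass_le S.two_le hB (Ne.symm hne)
  have h4 := norm_weierstrass_le S.two_le hB hne
  rw [norm_sub_rev (ehrlichSeq f z k j)] at h4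
  have hpos := norm_sub_pos hB (Ne.symm hne)
  have h5 := mul_le_mul_of_nonneg_right (hB.pair i j (Ne.symm hne)) hpos.le
  have h6 := norm_sub_le (ehrlichSeq f z k i - ξ i) (ehrlichSeq f z k j - ξ j)
  rw [hij] at h1
  rw [hij, sub_sub_sub_cancel_right] at h6
  have h7 : M * (‖weierstrass f (ehrlichSeq f z k) i‖ + ‖weierstrass f (ehrlichSeq f z k) j‖) ≤
      M * (b * E p f (ehrlichSeq f z k) *
        ‖ehrlichSeq f z k i - ehrlichSeq f z k j‖) :=
    mul_le_mul_of_nonneg_left (by linarith) hM.le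
  have h8 := mul_lt_mul_of_pos_right hk hpos
  linarith

lemma exists_forall_le_of_tendsto {ι : Type*} [Finite ι] {u : ι → ℕ → ℝ} {l : ι → ℝ}
    (h : ∀ i, Filter.Tendsto (u i) Filter.atTop (nhds (l i))) :
    ∃ B, 0 < B ∧ ∀ i k, u i k ≤ B := by
  choose c hc using fun i => (h i).bddAbove_range
  obtain ⟨B, hB⟩ := (Set.finite_range c).bddAbove
  exact ⟨max B 1, by positivity, fun i k => (hc i ⟨k, rfl⟩).trans
    ((hB ⟨i, rfl⟩).trans (le_max_left _ _))⟩

/-- If the components of the limit `ξ` are distinct, the corrections are at most proportional to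
the errors, because `W_i(z) = (z_i - ξ_i) ∏_{j ≠ i} (z_i - ξ_j) / (z_i - z_j)` and the product has
a limit along the sequence. -/
lemma Setting.exists_norm_weierstrass_seq_le (S : Setting n f p q a b)
    (h : Admissible f p a b z) {ξ : Fin n → ℂ}
    (hξ : Filter.Tendsto (ehrlichSeq f z) Filter.atTop (nhds ξ)) (hinj : Function.Injective ξ) :
    ∃ B, 0 < B ∧ ∀ k i,
      ‖weierstrass f (ehrlichSeq f z k) i‖ ≤ B * ‖ehrlichSeq f z k i - ξ i‖ := by
  have hξ' := tendsto_pi_nhds.1 hξ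
  have hlim : ∀ i, Filter.Tendsto (fun k => ‖(∏ j ∈ Finset.univ.erase i,
      (ehrlichSeq f z k i - ξ j)) / ∏ j ∈ Finset.univ.erase i,
      (ehrlichSeq f z k i - ehrlichSeq f z k j)‖) Filter.atTop
      (nhds ‖(∏ j ∈ Finset.univ.erase i, (ξ i - ξ j)) /
        ∏ j ∈ Finset.univ.erase i, (ξ i - ξ j)‖) := fun i =>
    ((tendsto_finsetProd _ fun j _ => (hξ' i).sub_const (ξ j)).div
      (tendsto_finsetProd _ fun j _ => (hξ' i).sub (hξ' j)) (prod_sub_ne_zero hinj i)).norm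
  obtain ⟨B, hB0, hB⟩ := exists_forall_le_of_tendsto hlim
  refine ⟨B, hB0, fun k i => ?_⟩
  have hW : weierstrass f (ehrlichSeq f z k) i = (∏ j ∈ Finset.univ.erase i,
      (ehrlichSeq f z k i - ξ j)) / (∏ j ∈ Finset.univ.erase i,
      (ehrlichSeq f z k i - ehrlichSeq f z k j)) * (ehrlichSeq f z k i - ξ i) := by
    have hev := congrArg (Polynomial.eval (ehrlichSeq f z k i)) (S.eq_prod_X_sub_C h hξ)
    rw [Polynomial.eval_prod] at hev
    simp only [Polynomial.eval_sub, Polynomial.eval_X, Polynomial.eval_C] at hev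
    rw [weierstrass, hev, ← Finset.prod_erase_mul _ _ (Finset.mem_univ i)]
    ring
  rw [hW, norm_mul]
  exact mul_le_mul_of_nonneg_right (hB i k) (norm_nonneg _)

lemma Setting.exists_one_le_mul_sep (S : Setting n f p q a b) {ξ : Fin n → ℂ}
    (hξ : Filter.Tendsto (ehrlichSeq f z) Filter.atTop (nhds ξ)) (hinj : Function.Injective ξ)
    (h : Admissible f p a b z) :
    ∃ D, 0 < D ∧ ∀ k i, 1 ≤ D * sep (ehrlichSeq f z k) i := by
  have hξ' := tendsto_pi_nhds.1 hξ
  have hlim : ∀ s : {s : Fin n × Fin n // s.2 ≠ s.1}, Filter.Tendsto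
      (fun k => ‖ehrlichSeq f z k s.1.1 - ehrlichSeq f z k s.1.2‖⁻¹) Filter.atTop
      (nhds ‖ξ s.1.1 - ξ s.1.2‖⁻¹) := fun s =>
    ((hξ' _).sub (hξ' _)).norm.inv₀
      (norm_ne_zero_iff.2 (sub_ne_zero.2 fun e => s.2 (hinj e).symm))
  obtain ⟨D, hD0, hD⟩ := exists_forall_le_of_tendsto hlim
  refine ⟨D, hD0, fun k i => ?_⟩
  rw [← div_le_iff₀' hD0]
  refine le_sep S.two_le _ i fun j hj => ?_
  have hpos := norm_sub_pos (S.stepBound (S.admissible_seq h k)) hj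
  rw [one_div]
  exact inv_le_of_inv_le₀ hpos (hD ⟨(i, j), hj⟩ k)

/-- With simple zeros in the limit, `‖z^{k+1} - ξ‖` is of the order of `‖W(z^{k+1})‖`, which is at
most `E(z^k)² H ‖W(z^k)‖`, and `E(z^k)` and `‖W(z^k)‖` are of the order of `‖z^k - ξ‖`. -/
lemma Setting.exists_cubic_bound (S : Setting n f p q a b) (h : Admissible f p a b z)
    (hlam : phi n a b (E p f z) < 1)
    {ξ : Fin n → ℂ} (hξ : Filter.Tendsto (ehrlichSeq f z) Filter.atTop (nhds ξ)) :
    ∃ C, ∀ k, pNorm p (ehrlichSeq f z (k + 1) - ξ) ≤ C * pNorm p (ehrlichSeq f z k - ξ) ^ 3 := by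
  have hinj := S.injective_limit h hlam hξ
  obtain ⟨M, hM0, hM⟩ := S.norm_seq_sub_le_const h hξ
  obtain ⟨B, hB0, hB⟩ := S.exists_norm_weierstrass_seq_le h hξ hinj
  obtain ⟨D, hD0, hD⟩ := S.exists_one_le_mul_sep hξ hinj h
  refine ⟨M * (B * D) ^ 2 * psiPhiFactor n a b (E p f z) * B, fun k => ?_⟩
  have hk := S.admissible_seq h k
  obtain ⟨hH0, hH⟩ := psiPhiFactor_mono S.two_le S.a_nonneg S.one_le_b (E_nonneg S.one_le f _)
    (S.E_seq_le_E h k) h.lt_one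
  have he := pNorm_nonneg S.one_le (ehrlichSeq f z k - ξ)
  have hE : E p f (ehrlichSeq f z k) ≤ B * D * pNorm p (ehrlichSeq f z k - ξ) := by
    refine pNorm_le_mul_of_norm_le S.one_le (by positivity) fun i => ?_
    have hs := sep_pos S.two_le hk.injective i
    rw [norm_div, Complex.norm_real, Real.norm_of_nonneg hs.le, div_le_iff₀ hs]
    calc _ ≤ B * ‖ehrlichSeq f z k i - ξ i‖ * 1 := by rw [mul_one]; exact hB k i
      _ ≤ B * ‖ehrlichSeq f z k i - ξ i‖ * (D * sep (ehrlichSeq f z k) i) :=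
          mul_le_mul_of_nonneg_left (hD k i) (by positivity)
      _ = B * D * ‖ehrlichSeq f z k i - ξ i‖ * sep (ehrlichSeq f z k) i := by ring
  have hE0 := E_nonneg S.one_le f (ehrlichSeq f z k)
  have hHz := hH0.trans hH
  have hW : pNorm p (weierstrass f (ehrlichSeq f z k)) ≤
      B * pNorm p (ehrlichSeq f z k - ξ) :=
    pNorm_le_mul_of_norm_le S.one_le hB0.le (hB k)
  have hW' : pNorm p (weierstrass f (ehrlichSeq f z (k + 1))) ≤
      psi a b (E p f (ehrlichSeq f z k)) * phi n a b (E p f (ehrlichSeq f z k)) *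
        pNorm p (weierstrass f (ehrlichSeq f z k)) :=
    pNorm_le_mul_of_norm_le S.one_le (mul_nonneg (S.psi_pos hk).le (S.phi_nonneg hk))
      (S.norm_weierstrass_seq_succ_le h k)
  rw [psi_mul_phi_eq n hk.lt_one] at hW'
  calc pNorm p (ehrlichSeq f z (k + 1) - ξ)
      ≤ M * pNorm p (weierstrass f (ehrlichSeq f z (k + 1))) :=
        pNorm_le_mul_of_norm_le S.one_le hM0.le (hM (k + 1))
    _ ≤ M * ((B * D * pNorm p (ehrlichSeq f z k - ξ)) ^ 2 * psiPhiFactor n a b (E p f z) *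
          (B * pNorm p (ehrlichSeq f z k - ξ))) := by
        refine mul_le_mul_of_nonneg_left (hW'.trans ?_) hM0.le
        exact mul_le_mul (mul_le_mul (pow_le_pow_left₀ hE0 hE 2) hH hH0 (by positivity)) hW
          (pNorm_nonneg S.one_le _) (by positivity)
    _ = _ := by ring

end Sequence

end Ehrlich

theorem mainTheorem2 (n : ℕ) (hn : 2 ≤ n) (f : Polynomial ℂ) (hf : f.Monic)
    (hdeg : f.natDegree = n) (p q : ℝ≥0∞) (hp : 1 ≤ p) (hpq : 1 / p + 1 / q = 1)
    (a b : ℝ) (ha : a = ((n : ℝ) - 1) ^ (1 / q).toReal) (hb : b = (2 : ℝ) ^ (1 / q).toReal)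
    (z0 : Fin n → ℂ) (hz0 : Function.Injective z0)
    (hE : Ehrlich.E p f z0 < 1 / (a + b))
    (hphi : Ehrlich.phi n a b (Ehrlich.E p f z0) ≤ 1)
    (z : ℕ → Fin n → ℂ) (hz : z = Ehrlich.ehrlichSeq f z0)
    (lam theta : ℝ) (hlam : lam = Ehrlich.phi n a b (Ehrlich.E p f z0))
    (htheta : theta = Ehrlich.psi a b (Ehrlich.E p f z0)) :
    -- the iteration is well defined
    (∀ k, Ehrlich.InDomain f (z k)) ∧
    ∃ ξ : Fin n → ℂ, Ehrlich.IsRootVector f ξ ∧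
      Filter.Tendsto z Filter.atTop (nhds ξ) ∧
      -- cubic order
      (lam < 1 → Ehrlich.ConvergesWithOrder p 3 z ξ) ∧
      -- a priori estimate; the exponent `(3 ^ k - 1) / 2` is an integer
      (∀ k, 1 ≤ k →
        theta * lam ^ 3 ^ k < 1 ∧
        Ehrlich.pNorm p (z k - ξ) ≤
          Ehrlich.mu a (Ehrlich.E p f z0 * lam ^ ((3 ^ k - 1) / 2)) *
            (theta ^ k * lam ^ ((3 ^ k - 1) / 2) / (1 - theta * lam ^ 3 ^ k)) *
            Ehrlich.pNorm p (Ehrlich.weierstrass f z0)) ∧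
      -- a posteriori estimate
      (∀ k,
        Ehrlich.E p f (z k) < 1 / (a + b) ∧
        Ehrlich.psi a b (Ehrlich.E p f (z k)) * Ehrlich.phi n a b (Ehrlich.E p f (z k)) < 1 ∧
        Ehrlich.pNorm p (z k - ξ) ≤
          Ehrlich.mu a (Ehrlich.E p f (z k)) /
            (1 - Ehrlich.psi a b (Ehrlich.E p f (z k)) *
              Ehrlich.phi n a b (Ehrlich.E p f (z k))) *
            Ehrlich.pNorm p (Ehrlich.weierstrass f (z k))) := by
  have S : Ehrlich.Setting n f p q a b := ⟨hn, hf, hdeg, hp, hpq, ha, hb⟩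
  have hab : 0 < a + b := by linarith [S.a_nonneg, S.one_le_b]
  have h : Ehrlich.Admissible f p a b z0 := ⟨hz0, (lt_div_iff₀' hab).1 hE, hphi⟩
  subst hz hlam htheta
  obtain ⟨ξ, hξ⟩ := S.exists_tendsto h
  refine ⟨fun k => Ehrlich.inDomain hn hf hdeg S.one_le_b (S.stepBound (S.admissible_seq h k)),
    ξ, S.isRootVector h hξ, hξ, fun hlt => ⟨hξ, S.exists_cubic_bound h hlt hξ⟩,
    fun k _ => ⟨S.psi_mul_phi_pow_lt_one h k, S.pNorm_seq_sub_le_apriori h hξ k⟩, fun k => ?_⟩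
  have hk := S.admissible_seq h k
  exact ⟨(lt_div_iff₀' hab).2 hk.lt_one, S.psi_mul_phi_lt_one hk, S.pNorm_seq_sub_le h hξ k⟩
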